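/- Let $d \ge 1$ and $n \ge 2$ be integers. For $h, m, r \ge 1$, a Transformer block with $h$ heads of size $m$ and $r$ hidden nodes is a map $\mathbb{R}^{d\times n} \to \mathbb{R}^{d\times n}$, $X \mapsto \mathrm{FF}(\mathrm{Attn}(X))$, where $$\mathrm{Attn}(X) = X + \sum_{i=1}^h W_O^i W_V^i X \cdot \sigma\big[(W_K^i X)^T (W_Q^i X + b_Q^i \mathbf{1}_n^T)\big],$$ $$\mathrm{FF}(Z) = Z + W_2 \cdot \mathrm{ReLU}(W_1 Z + b_1 \mathbf{1}_n^T) + b_2 \mathbf{1}_n^T,$$ with parameters $W_O^i \in \mathbb{R}^{d\times m}$, $W_V^i, W_K^i, W_Q^i \in \mathbb{R}^{m\times d}$, $b_Q^i \in \mathbb{R}^m$, $W_1 \in \mathbb{R}^{r\times d}$, $b_1 \in \mathbb{R}^r$, $W_2 \in \mathbb{R}^{d\times r}$, $b_2 \in \mathbb{R}^d$; here $\sigma$ applies the softmax to each column, $\mathrm{ReLU}(t)=\max(t,0)$ acts entry-wise, and $\mathbf{1}_n\in\mathbb{R}^n$ is the all-ones vector. Let $\mathcal{T}^{h,m,r}$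 be the set of all finite compositions of one or more such blocks, and let $$\mathcal{T}^{h,m,r}_{\mathrm{P}} = \{\, X \mapsto g(X+E) \;:\; g \in \mathcal{T}^{h,m,r},\ E \in \mathbb{R}^{d\times n} \,\}.$$ Theorem. Let $1 \le p < \infty$ and $\epsilon > 0$, let $D \subset \mathbb{R}^{d\times n}$ be compact, and let $f : D \to \mathbb{R}^{d\times n}$ be continuous. Then there exists $g \in \mathcal{T}^{2,1,4}_{\mathrm{P}}$ such that $$\mathsf{d}_p(f,g) = \Big(\int_D \|f(X)-g(X)\|_p^p \, dX\Big)^{1/p} \le \epsilon,$$ where $\|A\|_p = \big(\sum_{i,j} |A_{i,j}|^p\big)^{1/p}$ is the entry-wise $\ell^p$ norm and $dX$ is Lebesgue measure on $\mathbb{R}^{d\times n}$. -/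

import Mathlib

open scoped Matrix ENNReal

namespace SeqTransformer

noncomputable section

/-- The softmax operator, applied to each column of a matrix. -/
def colSoftmax {k n : ℕ} (A : Matrix (Fin k) (Fin n) ℝ) : Matrix (Fin k) (Fin n) ℝ :=
  Matrix.of fun i j => Real.exp (A i j) / ∑ l, Real.exp (A l j)

/-- The entry-wise ReLU. -/
def relu {k n : ℕ} (A : Matrix (Fin k) (Fin n) ℝ) : Matrix (Fin k) (Fin n) ℝ :=
  A.map fun t => max t 0

/-- The matrix `b 1ₙᵀ`, whose columns are all equal to `b`. -/
def addCols {k : ℕ} (n : ℕ) (b : Fin k → ℝ) : Matrix (Fin k) (Fin n) ℝ :=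
  Matrix.vecMulVec b fun _ => 1

/-- The parameters of a Transformer block on `d`-dimensional tokens, with `h` attention heads of
size `m` (with query biases `bQ`) and a feed-forward layer with `r` hidden nodes. -/
structure Block (d h m r : ℕ) where
  WO : Fin h → Matrix (Fin d) (Fin m) ℝ
  WV : Fin h → Matrix (Fin m) (Fin d) ℝ
  WK : Fin h → Matrix (Fin m) (Fin d) ℝ
  WQ : Fin h → Matrix (Fin m) (Fin d) ℝ
  bQ : Fin h → Fin m → ℝ
  W₁ : Matrix (Fin r) (Fin d) ℝ
  b₁ : Fin r → ℝ
  W₂ : Matrix (Fin d) (Fin r) ℝ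
  b₂ : Fin d → ℝ

namespace Block

variable {d h m r : ℕ}

/-- The self-attention layer, with skip connection. -/
def attn (t : Block d h m r) {n : ℕ} (X : Matrix (Fin d) (Fin n) ℝ) : Matrix (Fin d) (Fin n) ℝ :=
  X + ∑ i, t.WO i * (t.WV i * X) *
    colSoftmax ((t.WK i * X)ᵀ * (t.WQ i * X + addCols n (t.bQ i)))

/-- The token-wise feed-forward layer, with skip connection. -/
def ff (t : Block d h m r) {n : ℕ} (Z : Matrix (Fin d) (Fin n) ℝ) : Matrix (Fin d) (Fin n) ℝ :=
  Z + t.W₂ * relu (t.W₁ * Z + addCols n t.b₁) + addCols n t.b₂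

/-- The function on sequences of length `n` defined by a Transformer block. -/
def toFun (t : Block d h m r) (n : ℕ) (X : Matrix (Fin d) (Fin n) ℝ) : Matrix (Fin d) (Fin n) ℝ :=
  t.ff (t.attn X)

end Block

/-- `g` is a composition of (one or more) Transformer blocks with `h` heads of size `m` and
`r` hidden nodes. -/
inductive IsNetwork (d n h m r : ℕ) :
    (Matrix (Fin d) (Fin n) ℝ → Matrix (Fin d) (Fin n) ℝ) → Prop
  | block (t : Block d h m r) : IsNetwork d n h m r (t.toFun n)
  | comp {g₁ g₂ : Matrix (Fin d) (Fin n) ℝ → Matrix (Fin d) (Fin n) ℝ} :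
      IsNetwork d n h m r g₁ → IsNetwork d n h m r g₂ → IsNetwork d n h m r (g₂ ∘ g₁)

/-- The class of Transformer networks. -/
def networks (d n h m r : ℕ) : Set (Matrix (Fin d) (Fin n) ℝ → Matrix (Fin d) (Fin n) ℝ) :=
  {g | IsNetwork d n h m r g}

/-- The class of Transformer networks with an additive positional encoding `E`. -/
def networksPE (d n h m r : ℕ) : Set (Matrix (Fin d) (Fin n) ℝ → Matrix (Fin d) (Fin n) ℝ) :=
  {gP | ∃ g ∈ networks d n h m r, ∃ E : Matrix (Fin d) (Fin n) ℝ, gP = fun X => g (X + E)}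

/-- The entry-wise `ℓᵖ` norm of a matrix. -/
def entryNorm {d n : ℕ} (p : ℝ) (A : Matrix (Fin d) (Fin n) ℝ) : ℝ :=
  (∑ i, ∑ j, |A i j| ^ p) ^ (1 / p)

/-- The distance `(∫_D ‖f₁ X - f₂ X‖_p ^ p dX) ^ (1 / p)` of two functions on the domain `D`, with
respect to Lebesgue measure on `d × n` matrices. It is a lower Lebesgue integral with values
in `[0, ∞]`, so it is never a default value. -/
def dist {d n : ℕ} (p : ℝ) (D : Set (Matrix (Fin d) (Fin n) ℝ))
    (f₁ f₂ : Matrix (Fin d) (Fin n) ℝ → Matrix (Fin d) (Fin n) ℝ) : ℝ≥0∞ :=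
  (∫⁻ X : Fin d → Fin n → ℝ in {X | Matrix.of X ∈ D},
    ENNReal.ofReal (entryNorm p (f₁ (Matrix.of X) - f₂ (Matrix.of X)) ^ p)) ^ (1 / p)

end

end SeqTransformer

/-! Feed-forward layers do all the token-wise work, and one uniform attention layer supplies all the
context. The positional encoding shifts different columns to disjoint ranges; piecewise linear
layers then round the entries to a grid, off a set of small measure, so that finitely many sequences
remain (`exists_network_quantize`).

The grid tokens are sent to distinct powers of two, and attention adds `√2` times their sum. By
irrationality of `√2` and uniqueness of binary expansions, each resulting token determines the whole
sequence and its own position (`contextual_injective`). Hence a further token map, which moves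
tokens one at a time by hat functions (`exists_tokenMap_forall_mem`), can produce the desired values
(`exists_network_grid`). A final clamp bounds the error on the exceptional set, whose share of the
integral is therefore small. -/

namespace SeqTransformer

variable {d n : ℕ}

/-! ### Token maps and interpolation at finitely many tokens -/

/-- The map on sequences that applies `φ` to every token, that is, to every column. -/
def tokenwise (n : ℕ) (φ : (Fin d → ℝ) → Fin d → ℝ) (X : Matrix (Fin d) (Fin n) ℝ) :
    Matrix (Fin d) (Fin n) ℝ :=
  Matrix.of fun i j => φ (fun l => X l j) i

/-- The maps on tokens whose token-wise application is a Transformer network. -/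
def tokenMaps (d n : ℕ) : Set ((Fin d → ℝ) → Fin d → ℝ) :=
  {φ | tokenwise n φ ∈ networks d n 2 1 4}

theorem comp_mem_networks {h m r : ℕ} {g₁ g₂ : Matrix (Fin d) (Fin n) ℝ → Matrix (Fin d) (Fin n) ℝ}
    (h₂ : g₂ ∈ networks d n h m r) (h₁ : g₁ ∈ networks d n h m r) :
    g₂ ∘ g₁ ∈ networks d n h m r :=
  IsNetwork.comp h₁ h₂

theorem comp_mem_tokenMaps {φ ψ : (Fin d → ℝ) → Fin d → ℝ} (hφ : φ ∈ tokenMaps d n)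
    (hψ : ψ ∈ tokenMaps d n) : φ ∘ ψ ∈ tokenMaps d n :=
  comp_mem_networks (g₂ := tokenwise n φ) (g₁ := tokenwise n ψ) hφ hψ

/-- One feed-forward layer with skip connection, as a map on tokens. -/
theorem feedForward_mem_tokenMaps (α : Fin 4 → Fin d → ℝ) (β : Fin 4 → ℝ)
    (u : Fin 4 → Fin d → ℝ) :
    (fun x i => x i + ∑ k, u k i * max (∑ l, α k l * x l + β k) 0) ∈ tokenMaps d n := by
  have key : tokenwise n (fun x i => x i + ∑ k, u k i * max (∑ l, α k l * x l + β k) 0) =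
      Block.toFun (d := d) (h := 2) (m := 1) (r := 4)
        -- Zero output and value matrices switch attention off; only its skip connection remains.
        ⟨0, 0, 0, 0, 0, Matrix.of α, β, Matrix.of fun i k => u k i, 0⟩ n := by
    funext X
    ext i j
    simp [tokenwise, Block.toFun, Block.ff, Block.attn, relu, addCols, Matrix.mul_apply,
      Matrix.vecMulVec_apply]
  change _ ∈ networks d n 2 1 4
  rw [key]
  exact IsNetwork.block _

theorem ridge_mem_tokenMaps (a u : Fin d → ℝ) (α β γ : Fin 4 → ℝ) :
    (fun x i => x i + u i * ∑ k, γ k * max (α k * ∑ l, a l * x l + β k) 0) ∈ tokenMaps d n := by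
  convert feedForward_mem_tokenMaps (n := n) (fun k l => α k * a l) β (fun k i => u i * γ k) using 1
  funext x i
  simp only [Finset.mul_sum, mul_assoc]

theorem id_mem_tokenMaps : (id : (Fin d → ℝ) → Fin d → ℝ) ∈ tokenMaps d n := by
  convert ridge_mem_tokenMaps (n := n) (0 : Fin d → ℝ) 0 0 0 0 using 1
  funext x i
  simp

/-- Some linear functional separates a point from finitely many others by at least one. -/
theorem exists_one_le_abs_sum_mul_sub (S : Finset (Fin d → ℝ)) (x : Fin d → ℝ) (hx : x ∉ S) :
    ∃ a : Fin d → ℝ, ∀ s ∈ S, 1 ≤ |∑ l, a l * s l - ∑ l, a l * x l| := by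
  classical
  obtain ⟨f, hf⟩ := Module.exists_dual_forall_apply_ne_zero (K := ℝ)
    (fun s : S => (s : Fin d → ℝ) - x) fun s => sub_ne_zero.2 fun h => hx (h ▸ s.2)
  -- `f` is nonzero at every `s - x`; scaling by the sum of the inverses makes all these values at
  -- least one in size.
  set C := ∑ s ∈ S, |f (s - x)|⁻¹
  have hC : 0 ≤ C := Finset.sum_nonneg fun _ _ => by positivity
  refine ⟨fun l => C * f (Pi.single l 1), fun s hs => ?_⟩
  have hsum : ∑ l, C * f (Pi.single l 1) * s l - ∑ l, C * f (Pi.single l 1) * x l =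
      C * f (s - x) := by
    rw [LinearMap.pi_apply_eq_sum_univ f (s - x), Finset.mul_sum, ← Finset.sum_sub_distrib]
    refine Finset.sum_congr rfl fun l _ => ?_
    have : (fun j => if l = j then (1 : ℝ) else 0) = Pi.single l 1 := by
      funext j
      simp [Pi.single_apply, eq_comm]
    rw [this, Pi.sub_apply, smul_eq_mul]
    ring
  rw [hsum, abs_mul, abs_of_nonneg hC]
  have hpos : 0 < |f (s - x)| := abs_pos.2 (hf ⟨s, hs⟩)
  calc 1 = |f (s - x)|⁻¹ * |f (s - x)| := (inv_mul_cancel₀ hpos.ne').symm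
    _ ≤ C * |f (s - x)| := by
      gcongr
      exact Finset.single_le_sum (f := fun s => |f (s - x)|⁻¹) (fun _ _ => by positivity) hs

/-- A feed-forward layer can move one token anywhere while fixing finitely many others. -/
theorem exists_tokenMap_move (S : Finset (Fin d → ℝ)) (x y : Fin d → ℝ) (hx : x ∉ S) :
    ∃ φ ∈ tokenMaps d n, φ x = y ∧ ∀ s ∈ S, φ s = s := by
  obtain ⟨a, ha⟩ := exists_one_le_abs_sum_mul_sub S x hx
  -- With `t` the functional's value relative to `x`, this is the hat `ReLU(t+1) - 2 ReLU(t) +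
  -- ReLU(t-1)`, equal to 1 at `t = 0` and vanishing for `|t| ≥ 1`. The fourth hidden node is idle.
  refine ⟨_, ridge_mem_tokenMaps a (y - x) 1 (fun k => ![1, 0, -1, 0] k - ∑ l, a l * x l)
    ![1, -2, 1, 0], ?_, fun s hs => ?_⟩
  · funext i
    simp [Fin.sum_univ_four]
  · have h := ha s hs
    funext i
    have : ∑ k : Fin 4, (![1, -2, 1, 0] : Fin 4 → ℝ) k * max ((1 : Fin 4 → ℝ) k * ∑ l, a l * s l +
        (![1, 0, -1, 0] k - ∑ l, a l * x l)) 0 = 0 := by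
      simp only [Fin.sum_univ_four, Pi.one_apply, one_mul]
      simp only [Matrix.cons_val]
      rcases le_abs'.1 h with h | h
      · rw [max_eq_right, max_eq_right, max_eq_right] <;> linarith
      · rw [max_eq_left, max_eq_left, max_eq_left] <;> linarith
    simp only [this, mul_zero, add_zero]

/-- Token maps send finitely many distinct tokens into prescribed infinite sets. -/
theorem exists_tokenMap_forall_mem {ι : Type*} [Finite ι] (x : ι → Fin d → ℝ)
    (hx : Function.Injective x) (P : ι → Set (Fin d → ℝ)) (hP : ∀ i, (P i).Infinite) :
    ∃ φ ∈ tokenMaps d n, ∀ i, φ (x i) ∈ P i := by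
  classical
  have := Fintype.ofFinite ι
  suffices H : ∀ s : Finset ι, ∃ φ ∈ tokenMaps d n, (∀ i ∈ s, φ (x i) ∈ P i) ∧
      Function.Injective (φ ∘ x) by
    obtain ⟨φ, hφ, h, -⟩ := H Finset.univ
    exact ⟨φ, hφ, fun i => h i (Finset.mem_univ i)⟩
  intro s
  induction s using Finset.induction_on with
  | empty => exact ⟨id, id_mem_tokenMaps, by simp, hx⟩
  | insert i s his ih =>
    obtain ⟨φ, hφ, hs, hinj⟩ := ih
    -- The target avoids all current images, so the tokens stay distinct and the next one can still
    -- be moved alone.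
    obtain ⟨z, hz, hzr⟩ := (hP i).exists_notMem_finset (Finset.univ.image (φ ∘ x))
    obtain ⟨ψ, hψ, hψz, hψs⟩ := exists_tokenMap_move (n := n)
      ((Finset.univ.erase i).image (φ ∘ x)) (φ (x i)) z (by
        simp only [Finset.mem_image, Finset.mem_erase, not_exists, not_and]
        exact fun j hj hji => hj.1 (hinj hji))
    have hfix : ∀ j, j ≠ i → ψ (φ (x j)) = φ (x j) := fun j hj =>
      hψs _ (Finset.mem_image_of_mem (φ ∘ x) (by simp [hj]))
    have hne : ∀ j, φ (x j) ≠ z := fun j hj => hzr (by simp [← hj])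
    refine ⟨ψ ∘ φ, comp_mem_tokenMaps hψ hφ, ?_, ?_⟩
    · intro j hj
      rcases Finset.mem_insert.1 hj with rfl | hj
      · simpa [hψz] using hz
      · have : j ≠ i := fun h => his (h ▸ hj)
        simpa [hfix j this] using hs j hj
    · intro j k hjk
      simp only [Function.comp_apply] at hjk
      by_cases hj : j = i <;> by_cases hk : k = i
      · rw [hj, hk]
      · subst hj
        rw [hψz, hfix k hk] at hjk
        exact absurd hjk.symm (hne k)
      · subst hk
        rw [hψz, hfix j hj] at hjk
        exact absurd hjk (hne j)
      · rw [hfix j hj, hfix k hk] at hjk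
        exact hinj hjk

/-! ### Coordinate-wise piecewise linear maps and quantization -/

/-- A piecewise linear scalar map with four knots, applied to one coordinate, is a token map. -/
theorem update_mem_tokenMaps (i : Fin d) (α β γ : Fin 4 → ℝ) :
    (fun x => Function.update x i (x i + ∑ k, γ k * max (α k * x i + β k) 0)) ∈
      tokenMaps d n := by
  convert ridge_mem_tokenMaps (n := n) (Pi.single i 1) (Pi.single i 1) α β γ using 1
  funext x l
  rcases eq_or_ne l i with rfl | h
  · simp [Pi.single_apply]
  · simp [h, Pi.single_apply]

/-- The scalar maps whose coordinate-wise application is a token map, one coordinate at a time. -/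
def coordMaps (d n : ℕ) : Set (ℝ → ℝ) :=
  {q | ∀ i : Fin d, (fun x => Function.update x i (q (x i))) ∈ tokenMaps d n}

theorem comp_mem_coordMaps {p q : ℝ → ℝ} (hp : p ∈ coordMaps d n) (hq : q ∈ coordMaps d n) :
    p ∘ q ∈ coordMaps d n := by
  intro i
  convert comp_mem_tokenMaps (hp i) (hq i) using 1
  funext x
  simp

theorem id_mem_coordMaps : id ∈ coordMaps d n := by
  intro i
  convert id_mem_tokenMaps (d := d) (n := n) using 1
  funext x
  simp

theorem piecewiseLinear_mem_coordMaps (α β γ : Fin 4 → ℝ) :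
    (fun t => t + ∑ k, γ k * max (α k * t + β k) 0) ∈ coordMaps d n :=
  fun i => update_mem_tokenMaps i α β γ

theorem pi_mem_tokenMaps {q : ℝ → ℝ} (hq : q ∈ coordMaps d n) :
    (fun x i => q (x i)) ∈ tokenMaps d n := by
  classical
  suffices H : ∀ s : Finset (Fin d), (fun x i => if i ∈ s then q (x i) else x i) ∈ tokenMaps d n by
    simpa using H Finset.univ
  intro s
  induction s using Finset.induction_on with
  | empty => simp only [Finset.notMem_empty, if_false]; exact id_mem_tokenMaps
  | insert i s his ih =>
    convert comp_mem_tokenMaps (hq i) ih using 1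
    funext x l
    rcases eq_or_ne l i with rfl | h
    · simp [his]
    · simp [h]

/-- The clamp is `t - ReLU(t - B) + ReLU(-t - B)`, so two hidden nodes suffice. -/
theorem clamp_mem_coordMaps {B : ℝ} (hB : 0 ≤ B) :
    (fun t => max (-B) (min t B)) ∈ coordMaps d n := by
  convert piecewiseLinear_mem_coordMaps (d := d) (n := n) ![1, -1, 0, 0] ![-B, -B, 0, 0]
    ![-1, 1, 0, 0] using 1
  funext t
  simp only [Fin.sum_univ_four, Matrix.cons_val]
  rcases le_total t B with h | h <;> rcases le_total (-B) t with h' | h'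
  · rw [min_eq_left h, max_eq_right h', max_eq_right, max_eq_right] <;> linarith
  · rw [min_eq_left h, max_eq_left h', max_eq_right, max_eq_left] <;> linarith
  · rw [min_eq_right h, max_eq_right, max_eq_left, max_eq_right] <;> linarith
  · rw [min_eq_right h, max_eq_right, max_eq_left, max_eq_right] <;> linarith

/-- A map that flattens `[kw, (k + 1 - δ)w]` to a point and fixes everything outside
`[kw, (k + 1)w]`. -/
theorem exists_plateau_mem_coordMaps {w δ : ℝ} (hw : 0 < w) (hδ : 0 < δ) (hδ₁ : δ < 1) (k : ℕ) :
    ∃ q ∈ coordMaps d n, (∀ t ≤ k * w, q t = t) ∧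
      (∀ t, k * w ≤ t → t ≤ (k + 1 - δ) * w → q t = k * w) ∧ ∀ t, (k + 1) * w ≤ t → q t = t := by
  have hδw : 0 < δ * w := mul_pos hδ hw
  have hδw₁ : δ * w < w := by nlinarith
  -- The successive slopes are `1, 0, 1/δ, 1`: the steep piece regains the height `w` over a length
  -- `δ * w`.
  refine ⟨_, piecewiseLinear_mem_coordMaps 1
    ![-(k * w), -((k + 1 - δ) * w), -((k + 1) * w), 0] ![-1, 1 / δ, -(1 / δ - 1), 0], ?_, ?_, ?_⟩
  · intro t ht
    simp only [Fin.sum_univ_four, Matrix.cons_val, Pi.one_apply, one_mul]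
    rw [max_eq_right (by linarith), max_eq_right (by linarith), max_eq_right (by linarith)]
    simp
  · intro t ht ht'
    simp only [Fin.sum_univ_four, Matrix.cons_val, Pi.one_apply, one_mul]
    rw [max_eq_left (by linarith), max_eq_right (by linarith), max_eq_right (by linarith)]
    simp
  · intro t ht
    simp only [Fin.sum_univ_four, Matrix.cons_val, Pi.one_apply, one_mul]
    rw [max_eq_left (by linarith), max_eq_left (by linarith), max_eq_left (by linarith)]
    field_simp
    ring

/-- Quantization of the first `N` cells of a grid of mesh `w`. -/
theorem exists_quantize_mem_coordMaps {w δ : ℝ} (hw : 0 < w) (hδ : 0 < δ) (hδ₁ : δ < 1) (N : ℕ) :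
    ∃ q ∈ coordMaps d n, ∀ k < N, ∀ t, k * w ≤ t → t ≤ (k + 1 - δ) * w → q t = k * w := by
  suffices H : ∃ q ∈ coordMaps d n, ∀ (k : ℕ) (t : ℝ), k * w ≤ t → t ≤ (k + 1 - δ) * w →
      q t = if k < N then k * w else t by
    obtain ⟨q, hq, h⟩ := H
    exact ⟨q, hq, fun k hk t h₁ h₂ => by rw [h k t h₁ h₂, if_pos hk]⟩
  induction N with
  | zero => exact ⟨id, id_mem_coordMaps, by simp⟩
  | succ N ih =>
    obtain ⟨q, hq, h⟩ := ih
    obtain ⟨r, hr, h₁, h₂, h₃⟩ := exists_plateau_mem_coordMaps (d := d) (n := n) hw hδ hδ₁ N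
    refine ⟨r ∘ q, comp_mem_coordMaps hr hq, fun k t ht ht' => ?_⟩
    rw [Function.comp_apply, h k t ht ht']
    -- Earlier cells have already collapsed to points `k * w ≤ N * w`, and later cells start beyond
    -- the plateau's ramp; `r` fixes both.
    rcases lt_trichotomy k N with hk | rfl | hk
    · rw [if_pos hk, if_pos (by omega)]
      exact h₁ _ (by gcongr)
    · rw [if_neg (lt_irrefl _), if_pos (by omega)]
      exact h₂ t ht ht'
    · rw [if_neg (by omega), if_neg (by omega)]
      refine h₃ t (le_trans ?_ ht)
      have : (N : ℝ) + 1 ≤ k := by exact_mod_cast hk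
      gcongr

/-! ### Attention, contextual tokens and interpolation on grid sequences -/

/-- Uniform attention adds a multiple of the row sum of the first row to every entry. -/
theorem addSum_mem_networks (i₀ : Fin d) (c : ℝ) (hn : n ≠ 0) :
    (fun X : Matrix (Fin d) (Fin n) ℝ => Matrix.of fun i j => X i j + c * ∑ l, X i₀ l) ∈
      networks d n 2 1 4 := by
  have key : (fun X : Matrix (Fin d) (Fin n) ℝ => Matrix.of fun i j => X i j + c * ∑ l, X i₀ l) =
      Block.toFun (d := d) (h := 2) (m := 1) (r := 4)
        -- Zero keys and queries give softmax weights `1 / n`, which the factor `n` cancels. The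
        -- second head is switched off.
        ⟨![Matrix.of fun _ _ => c * n, 0], fun _ => Matrix.of fun _ => Pi.single i₀ 1, 0, 0, 0,
          0, 0, 0, 0⟩ n := by
    have hn' : (n : ℝ) ≠ 0 := by exact_mod_cast hn
    funext X
    ext i j
    simp [Block.toFun, Block.ff, Block.attn, relu, addCols, Matrix.mul_apply,
      colSoftmax, Pi.single_apply, Finset.mul_sum]
    refine Finset.sum_congr rfl fun l _ => ?_
    field_simp
  rw [key]
  exact IsNetwork.block _

/-- The tokens of the grid of mesh `w`, with `M` cells per coordinate for each position. -/
def gridToken (M : ℕ) (w : ℝ) (c : Fin n × (Fin d → Fin M)) (i : Fin d) : ℝ :=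
  ((c.2 i + c.1 * M : ℕ) : ℝ) * w

/-- Position and cell index are the quotient and remainder modulo `M`; the position can be read off
coordinate 0. -/
theorem gridToken_injective [NeZero d] (M : ℕ) {w : ℝ} (hw : w ≠ 0) :
    Function.Injective (gridToken (d := d) (n := n) M w) := by
  rintro ⟨j, c⟩ ⟨j', c'⟩ h
  have key : ∀ i, (c i : ℕ) + j * M = c' i + j' * M := fun i => by
    have := congrFun h i
    simpa only [gridToken, mul_left_inj' hw, Nat.cast_inj] using this
  have hj : j = j' := by
    have hM : 0 < M := (Nat.zero_le _).trans_lt (c 0).2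
    have := congrArg (· / M) (key 0)
    simp only [Nat.add_mul_div_right _ _ hM, Nat.div_eq_of_lt (c 0).2, Nat.div_eq_of_lt (c' 0).2,
      zero_add] at this
    exact Fin.ext this
  subst hj
  refine Prod.ext rfl (funext fun i => Fin.ext ?_)
  simpa using key i

/-- Some token map sends finitely many distinct tokens to constant vectors that are distinct
powers of two. -/
theorem exists_tokenMap_eq_two_pow [NeZero d] {ι : Type*} [Finite ι] (x : ι → Fin d → ℝ)
    (hx : Function.Injective x) :
    ∃ φ ∈ tokenMaps d n, ∃ e : ι → ℕ, Function.Injective e ∧ ∀ c, φ (x c) = fun _ => 2 ^ e c := by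
  obtain ⟨N, ⟨e₀⟩⟩ := Finite.exists_equiv_fin ι
  obtain ⟨φ, hφ, h⟩ := exists_tokenMap_forall_mem (n := n) x hx
    -- The residue of the exponent modulo `N` identifies `c`, so the exponents are distinct
    -- whichever `m` are chosen.
    (fun c => Set.range fun (m : ℕ) (_ : Fin d) => (2 : ℝ) ^ ((e₀ c : ℕ) + N * m)) (fun c => by
      have hN : 0 < N := (Nat.zero_le _).trans_lt (e₀ c).2
      refine Set.infinite_range_of_injective fun m m' hm => ?_
      have h2 := pow_right_injective₀ (two_pos : (0 : ℝ) < 2) (by norm_num) (congrFun hm 0)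
      exact Nat.eq_of_mul_eq_mul_left hN (Nat.add_left_cancel h2))
  choose m hm using h
  refine ⟨φ, hφ, fun c => e₀ c + N * m c, fun c c' hc => ?_, fun c => (hm c).symm⟩
  have := congrArg (· % N) hc
  simp only [Nat.add_mul_mod_self_left, Nat.mod_eq_of_lt (e₀ c).2,
    Nat.mod_eq_of_lt (e₀ c').2] at this
  exact e₀.injective (Fin.ext this)

/-- The contextual tokens, obtained by adding to each code an irrational multiple of the sum of all
the codes in the sequence, determine both the sequence and the position in it. -/
theorem contextual_injective {β : Type*} {e : Fin n × β → ℕ} (he : Function.Injective e) :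
    Function.Injective fun q : (Fin n → β) × Fin n =>
      (2 : ℝ) ^ e (q.2, q.1 q.2) + √2 * ∑ l, (2 : ℝ) ^ e (l, q.1 l) := by
  classical
  rintro ⟨κ, j⟩ ⟨κ', j'⟩ h
  have hsum : ∑ l, 2 ^ e (l, κ l) = ∑ l, 2 ^ e (l, κ' l) := by
    -- If the two sums differed, solving `h` for `√2` would express it as a ratio of integers.
    by_contra hne
    have hne' : ((∑ l, 2 ^ e (l, κ l) : ℕ) : ℝ) - (∑ l, 2 ^ e (l, κ' l) : ℕ) ≠ 0 := by
      rw [sub_ne_zero]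
      exact_mod_cast hne
    refine irrational_sqrt_two ⟨((2 ^ e (j', κ' j') : ℕ) - (2 ^ e (j, κ j) : ℕ)) /
      ((∑ l, 2 ^ e (l, κ l) : ℕ) - (∑ l, 2 ^ e (l, κ' l) : ℕ)), ?_⟩
    push_cast at hne' ⊢
    rw [div_eq_iff hne']
    simp only at h
    linarith
  have hinj : ∀ κ : Fin n → β, Function.Injective fun l => e (l, κ l) := fun κ l l' hl =>
    congrArg Prod.fst (he hl)
  have himg : Finset.univ.image (fun l => e (l, κ l)) =
      Finset.univ.image fun l => e (l, κ' l) := by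
    -- A finite set of exponents is determined by the sum of its powers of two; `hinj` rules out
    -- repeated exponents.
    refine Finset.geomSum_injective le_rfl ?_
    simpa only [Finset.sum_image (hinj _).injOn] using hsum
  have hκ : κ = κ' := by
    funext l
    have hl : e (l, κ l) ∈ Finset.univ.image fun l => e (l, κ' l) := by
      rw [← himg]
      exact Finset.mem_image_of_mem (fun l => e (l, κ l)) (Finset.mem_univ l)
    obtain ⟨l', -, hl'⟩ := Finset.mem_image.1 hl
    have := he hl'
    simp only [Prod.mk.injEq] at this
    obtain ⟨rfl, h⟩ := this
    exact h.symm
  subst hκ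
  refine Prod.ext rfl ?_
  simp only [add_left_inj] at h
  exact congrArg Prod.fst (he (pow_right_injective₀ (two_pos : (0 : ℝ) < 2) (by norm_num) h))

/-- Transformer networks interpolate arbitrary values on the sequences of grid tokens. -/
theorem exists_network_grid [NeZero d] (M : ℕ) {w η : ℝ} (hw : w ≠ 0) (hη : 0 < η)
    (A : (Fin n → Fin d → Fin M) → Fin d → Fin n → ℝ) :
    ∃ g ∈ networks d n 2 1 4, ∀ κ i j,
      |g (Matrix.of fun i j => gridToken M w (j, κ j) i) i j - A κ i j| < η := by
  rcases eq_or_ne n 0 with rfl | hn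
  · exact ⟨_, id_mem_tokenMaps, fun _ _ j => j.elim0⟩
  obtain ⟨φ, hφ, e, he, hφe⟩ := exists_tokenMap_eq_two_pow (n := n)
    (gridToken (d := d) (n := n) M w) (gridToken_injective M hw)
  obtain ⟨ψ, hψ, h⟩ := exists_tokenMap_forall_mem (n := n)
    (fun (q : (Fin n → Fin d → Fin M) × Fin n) (_ : Fin d) =>
      (2 : ℝ) ^ e (q.2, q.1 q.2) + √2 * ∑ l, (2 : ℝ) ^ e (l, q.1 l))
    (fun q q' hq => contextual_injective he (congrFun hq 0))
    (fun q => Metric.ball (fun i => A q.1 i q.2) η)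
    (fun q => infinite_of_mem_nhds _ (Metric.ball_mem_nhds _ hη))
  refine ⟨_, comp_mem_networks hψ (comp_mem_networks (addSum_mem_networks 0 (√2) hn) hφ),
    fun κ i j => ?_⟩
  have h₁ := (dist_le_pi_dist _ _ i).trans_lt (Metric.mem_ball.1 (h (κ, j)))
  have h₂ : ∀ l, (fun i => gridToken M w (l, κ l) i) = gridToken M w (l, κ l) := fun _ => rfl
  simpa only [Function.comp_apply, tokenwise, Matrix.of_apply, h₂, hφe, Real.dist_eq] using h₁

/-- On a bounded set of sequences, quantization of each entry, after a shift that separates the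
positions. -/
theorem exists_network_quantize {R w δ : ℝ} (hw : 0 < w) (hδ : 0 < δ) (hδ₁ : δ < 1) (M : ℕ) :
    ∃ g ∈ networksPE d n 2 1 4, ∀ (X : Matrix (Fin d) (Fin n) ℝ) (κ : Fin n → Fin d → Fin M),
      (∀ i j, (κ j i : ℕ) * w ≤ X i j + R ∧ X i j + R ≤ ((κ j i : ℕ) + 1 - δ) * w) →
      g X = Matrix.of fun i j => gridToken M w (j, κ j) i := by
  obtain ⟨q, hq, h⟩ := exists_quantize_mem_coordMaps (d := d) (n := n) hw hδ hδ₁ (n * M)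
  -- The encoding makes entries nonnegative and moves column `j` to the cells from `j * M` to `(j +
  -- 1) * M - 1`.
  refine ⟨_, ⟨_, pi_mem_tokenMaps hq, Matrix.of fun _ j => R + (j : ℕ) * M * w, rfl⟩,
    fun X κ hκ => ?_⟩
  ext i j
  have hlt : (κ j i : ℕ) + j * M < n * M := by
    calc (κ j i : ℕ) + j * M < M + j * M := by gcongr; exact (κ j i).2
      _ = (j + 1) * M := by ring
      _ ≤ n * M := Nat.mul_le_mul_right _ j.2
  have := h _ hlt (X i j + (R + (j : ℕ) * M * w))
    (by push_cast; nlinarith [(hκ i j).1]) (by push_cast; nlinarith [(hκ i j).2])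
  simpa [tokenwise, gridToken] using this

theorem comp_mem_networksPE {h m r : ℕ} {g₁ g₂ : Matrix (Fin d) (Fin n) ℝ → Matrix (Fin d) (Fin n) ℝ}
    (h₂ : g₂ ∈ networks d n h m r) (h₁ : g₁ ∈ networksPE d n h m r) :
    g₂ ∘ g₁ ∈ networksPE d n h m r := by
  obtain ⟨g, hg, E, rfl⟩ := h₁
  exact ⟨g₂ ∘ g, comp_mem_networks h₂ hg, E, rfl⟩

/-! ### The exceptional set and approximation off it -/

open MeasureTheory Filter

theorem exists_abs_apply_le_of_isCompact {D : Set (Fin d → Fin n → ℝ)} (hD : IsCompact D) :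
    ∃ R : ℝ, 0 < R ∧ ∀ X ∈ D, ∀ i j, |X i j| ≤ R := by
  obtain ⟨R, hR, h⟩ := hD.isBounded.exists_pos_norm_le
  exact ⟨R, hR, fun X hX i j => (norm_le_pi_norm (X i) j).trans ((norm_le_pi_norm X i).trans (h X hX))⟩

/-- The sequences with an entry in the last part, of relative length `δ`, of its cell of the grid
of mesh `w` with origin `-R`. -/
def nearGrid (d n : ℕ) (R w δ : ℝ) : Set (Fin d → Fin n → ℝ) :=
  {X | ∃ i j, 1 - δ < Int.fract ((X i j + R) / w)}

theorem measurableSet_nearGrid (R w δ : ℝ) : MeasurableSet (nearGrid d n R w δ) := by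
  have : nearGrid d n R w δ = ⋃ i, ⋃ j, {X | 1 - δ < Int.fract ((X i j + R) / w)} := by
    ext X
    simp [nearGrid]
  rw [this]
  refine MeasurableSet.iUnion fun i => MeasurableSet.iUnion fun j =>
    measurableSet_lt measurable_const ?_
  fun_prop

/-- Almost all of a set of finite measure is away from the ends of the grid cells. -/
theorem exists_measure_nearGrid_lt (μ : Measure (Fin d → Fin n → ℝ)) [IsFiniteMeasure μ] (R w : ℝ)
    {ν : ℝ≥0∞} (hν : ν ≠ 0) : ∃ δ : ℝ, 0 < δ ∧ δ < 1 ∧ μ (nearGrid d n R w δ) < ν := by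
  have hδ : ∀ k : ℕ, (0 : ℝ) < 1 / (k + 2) := fun k => by positivity
  have hanti : Antitone fun k : ℕ => nearGrid d n R w (1 / (k + 2)) := by
    rintro k l hkl X ⟨i, j, h⟩
    refine ⟨i, j, lt_of_le_of_lt ?_ h⟩
    gcongr
  have hempty : ⋂ k : ℕ, nearGrid d n R w (1 / (k + 2)) = ∅ := by
    -- Fractional parts are strictly below 1 and there are finitely many entries, so each `X` leaves
    -- the sets eventually. Continuity of `μ` from above then applies.
    refine Set.eq_empty_of_forall_notMem fun X hX => ?_
    have hex : ∀ i j, ∀ᶠ k : ℕ in atTop, Int.fract ((X i j + R) / w) ≤ 1 - 1 / ((k : ℝ) + 2) := by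
      intro i j
      have hlim : Tendsto (fun k : ℕ => 1 - 1 / ((k : ℝ) + 2)) atTop (nhds (1 - 0)) :=
        tendsto_const_nhds.sub <| tendsto_const_nhds.div_atTop <|
          tendsto_atTop_add_const_right _ _ tendsto_natCast_atTop_atTop
      rw [sub_zero] at hlim
      exact (hlim.eventually (lt_mem_nhds (Int.fract_lt_one _))).mono fun k hk => hk.le
    obtain ⟨k, hk⟩ := (eventually_all.2 fun i => eventually_all.2 (hex i)).exists
    obtain ⟨i, j, h⟩ := Set.mem_iInter.1 hX k
    exact h.not_ge (hk i j)
  have hlim := tendsto_measure_iInter_atTop (μ := μ)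
    (fun k => (measurableSet_nearGrid (d := d) (n := n) R w (1 / ((k : ℕ) + 2))).nullMeasurableSet)
    hanti ⟨0, measure_ne_top _ _⟩
  rw [hempty, measure_empty] at hlim
  obtain ⟨k, hk⟩ := (hlim.eventually (gt_mem_nhds (pos_iff_ne_zero.2 hν))).exists
  refine ⟨_, hδ k, ?_, hk⟩
  rw [div_lt_one (by positivity)]
  linarith [Nat.cast_nonneg (α := ℝ) k]

theorem abs_clamp_le {B : ℝ} (hB : 0 ≤ B) (t : ℝ) : |max (-B) (min t B)| ≤ B :=
  abs_le.2 ⟨le_max_left _ _, max_le (by linarith) (min_le_right _ _)⟩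

theorem abs_clamp_sub_le {B s : ℝ} (hs : |s| ≤ B) (t : ℝ) : |max (-B) (min t B) - s| ≤ |t - s| := by
  obtain ⟨h₁, h₂⟩ := abs_le.1 hs
  have hs' : max (-B) (min s B) = s := by rw [min_eq_left h₂, max_eq_right h₁]
  calc |max (-B) (min t B) - s| = |max (min t B) (-B) - max (min s B) (-B)| := by
        rw [max_comm (min s B), hs', max_comm]
    _ ≤ |min t B - min s B| := abs_max_sub_max_le_abs _ _ _
    _ ≤ |t - s| := by simpa using abs_min_sub_min_le_max t B s B

/-- A continuous function on a compact set is uniformly approximated by bounded Transformer networks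
with positional encoding, off a set of small measure. -/
theorem exists_networkPE_approx [NeZero d] (μ : Measure (Fin d → Fin n → ℝ)) [IsFiniteMeasure μ]
    {D : Set (Fin d → Fin n → ℝ)} (hD : IsCompact D)
    {f : (Fin d → Fin n → ℝ) → Fin d → Fin n → ℝ} (hf : ContinuousOn f D) {B : ℝ} (hB : 0 ≤ B)
    (hfB : ∀ X ∈ D, ∀ i j, |f X i j| ≤ B) {η : ℝ} (hη : 0 < η) {ν : ℝ≥0∞} (hν : ν ≠ 0) :
    ∃ S, MeasurableSet S ∧ μ S < ν ∧ ∃ g ∈ networksPE d n 2 1 4,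
      (∀ X i j, |g X i j| ≤ B) ∧
      ∀ X ∈ D, X ∉ S → ∀ i j, |g (Matrix.of X) i j - f X i j| ≤ η := by
  classical
  obtain ⟨R, hR, hDR⟩ := exists_abs_apply_le_of_isCompact hD
  obtain ⟨r, hr, huc⟩ := Metric.uniformContinuousOn_iff.1
    (hD.uniformContinuousOn_of_continuous hf) (η / 2) (half_pos hη)
  -- Two sequences in the same cell are at sup distance at most `w < r`.
  set w := r / 2
  have hw : 0 < w := half_pos hr
  obtain ⟨M, hM⟩ := exists_nat_gt (2 * R / w)
  rw [div_lt_iff₀ hw] at hM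
  obtain ⟨δ, hδ, hδ₁, hμ⟩ := exists_measure_nearGrid_lt μ R w hν
  have hcell : ∀ X ∈ D, ∃ κ : Fin n → Fin d → Fin M, ∀ i j,
      ((κ j i : ℕ) : ℝ) = ⌊(X i j + R) / w⌋ := by
    intro X hX
    have hpos : ∀ i j, 0 ≤ (X i j + R) / w := fun i j =>
      div_nonneg (by linarith [(abs_le.1 (hDR X hX i j)).1]) hw.le
    refine ⟨fun j i => ⟨⌊(X i j + R) / w⌋₊, ?_⟩, fun i j => natCast_floor_eq_intCast_floor (hpos i j)⟩
    rw [Nat.floor_lt (hpos i j), div_lt_iff₀ hw]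
    linarith [(abs_le.1 (hDR X hX i j)).2]
  have hA : ∀ κ : Fin n → Fin d → Fin M, ∃ a : Fin d → Fin n → ℝ, ∀ X ∈ D,
      (∀ i j, ((κ j i : ℕ) : ℝ) = ⌊(X i j + R) / w⌋) → ∀ i j, |a i j - f X i j| ≤ η / 2 := by
    intro κ
    -- The value for a cell is that of `f` at any point of `D` in it; a cell missing `D` imposes no
    -- condition.
    by_cases hex : ∃ Y ∈ D, ∀ i j, ((κ j i : ℕ) : ℝ) = ⌊(Y i j + R) / w⌋
    · obtain ⟨Y, hY, hYκ⟩ := hex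
      refine ⟨f Y, fun X hX hXκ i j => ?_⟩
      have hdist : Dist.dist Y X ≤ w := by
        refine (dist_pi_le_iff hw.le).2 fun i => (dist_pi_le_iff hw.le).2 fun j => ?_
        have : |(Y i j + R) / w - (X i j + R) / w| < 1 :=
          Int.abs_sub_lt_one_of_floor_eq_floor (by
            exact_mod_cast (hYκ i j).symm.trans (hXκ i j))
        rw [← sub_div, abs_div, abs_of_pos hw, div_lt_one hw, add_sub_add_right_eq_sub] at this
        exact this.le
      have := huc Y hY X hX (hdist.trans_lt (half_lt_self hr))
      exact ((dist_le_pi_dist (f Y i) (f X i) j).trans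
        ((dist_le_pi_dist (f Y) (f X) i).trans this.le))
    · exact ⟨0, fun X hX hXκ => absurd ⟨X, hX, hXκ⟩ hex⟩
  choose A hA using hA
  obtain ⟨g₁, hg₁, h₁⟩ := exists_network_quantize (d := d) (n := n) (R := R) hw hδ hδ₁ M
  obtain ⟨g₂, hg₂, h₂⟩ := exists_network_grid M hw.ne' (half_pos hη) A
  refine ⟨_, measurableSet_nearGrid R w δ, hμ, _,
    comp_mem_networksPE (pi_mem_tokenMaps (clamp_mem_coordMaps hB))
      (comp_mem_networksPE hg₂ hg₁), fun X i j => abs_clamp_le hB _, fun X hX hXS i j => ?_⟩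
  obtain ⟨κ, hκ⟩ := hcell X hX
  have hq := h₁ (Matrix.of X) κ fun i j => by
    have hfr : Int.fract ((X i j + R) / w) ≤ 1 - δ := not_lt.1 fun h => hXS ⟨i, j, h⟩
    rw [Int.fract] at hfr
    rw [← le_div_iff₀ hw, ← div_le_iff₀ hw, hκ]
    exact ⟨Int.floor_le _, by simpa using by linarith⟩
  refine (abs_clamp_sub_le (hfB X hX i j) _).trans ?_
  change |g₂ (g₁ (Matrix.of X)) i j - f X i j| ≤ η
  rw [hq]
  have e₁ := h₂ κ i j
  have e₂ := hA κ X hX hκ i j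
  exact (abs_sub_le _ (A κ i j) _).trans (by linarith)

/-! ### The `Lᵖ` estimate -/

theorem entryNorm_rpow {p : ℝ} (hp : p ≠ 0) (A : Matrix (Fin d) (Fin n) ℝ) :
    entryNorm p A ^ p = ∑ i, ∑ j, |A i j| ^ p := by
  rw [entryNorm, ← Real.rpow_mul (by positivity), one_div_mul_cancel hp, Real.rpow_one]

theorem entryNorm_rpow_le {p : ℝ} (hp : 0 < p) {A : Matrix (Fin d) (Fin n) ℝ} {C : ℝ}
    (hA : ∀ i j, |A i j| ≤ C) : entryNorm p A ^ p ≤ d * n * C ^ p := by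
  rw [entryNorm_rpow hp.ne']
  calc ∑ i, ∑ j, |A i j| ^ p ≤ ∑ _i : Fin d, ∑ _j : Fin n, C ^ p := by
        gcongr with i _ j _
        exact hA i j
    _ = d * n * C ^ p := by simp [mul_assoc]

end SeqTransformer

theorem theorem2 (d n : ℕ) (hn : 2 ≤ n) (p : ℝ) (hp : 1 ≤ p) (ε : ℝ) (hε : 0 < ε)
    (D : Set (Matrix (Fin d) (Fin n) ℝ)) (hD : IsCompact D)
    (f : Matrix (Fin d) (Fin n) ℝ → Matrix (Fin d) (Fin n) ℝ) (hf : ContinuousOn f D) :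
    ∃ g ∈ SeqTransformer.networksPE d n 2 1 4,
      SeqTransformer.dist p D f g ≤ ENNReal.ofReal ε := by
  have hp₀ : 0 < p := one_pos.trans_le hp
  rcases Nat.eq_zero_or_pos d with rfl | hd
  -- There are no entries when `d = 0`, so any network has distance zero.
  · exact ⟨_, ⟨_, SeqTransformer.IsNetwork.block ⟨0, 0, 0, 0, 0, 0, 0, 0, 0⟩, 0, rfl⟩, by
      simp [SeqTransformer.dist, SeqTransformer.entryNorm_rpow hp₀.ne', hp₀]⟩
  have : NeZero d := ⟨hd.ne'⟩
  set D' : Set (Fin d → Fin n → ℝ) := {X | Matrix.of X ∈ D}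
  have hD' : IsCompact D' := hD
  obtain ⟨B, hB, hfB⟩ : ∃ B : ℝ, 0 < B ∧ ∀ X ∈ D, ∀ i j, |f X i j| ≤ B := by
    obtain ⟨B, hB, h⟩ := SeqTransformer.exists_abs_apply_le_of_isCompact (hD.image_of_continuousOn hf)
    exact ⟨B, hB, fun X hX => h _ (Set.mem_image_of_mem f hX)⟩
  have : MeasureTheory.IsFiniteMeasure (MeasureTheory.volume.restrict D') := ⟨by
    simpa using hD'.measure_lt_top⟩
  set V := (MeasureTheory.volume D').toReal
  have hV : 0 ≤ V := ENNReal.toReal_nonneg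
  have hVD : MeasureTheory.volume D' = ENNReal.ofReal V := (ENNReal.ofReal_toReal hD'.measure_lt_top.ne).symm
  have hεp : 0 < ε ^ p := Real.rpow_pos_of_pos hε p
  have hn₀ : (0 : ℝ) < n := by exact_mod_cast (by omega : 0 < n)
  have hd₀ : (0 : ℝ) < d := by exact_mod_cast hd
  obtain ⟨η, hη, hηV⟩ : ∃ η : ℝ, 0 < η ∧ d * n * η ^ p * V ≤ ε ^ p / 2 := by
    -- Half of the budget `ε ^ p` goes to the points off `S`; `V + 1` keeps the quotient meaningful
    -- when `V = 0`.
    refine ⟨(ε ^ p / 2 / (d * n * (V + 1))) ^ (1 / p), by positivity, ?_⟩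
    rw [← Real.rpow_mul (by positivity), one_div_mul_cancel hp₀.ne', Real.rpow_one]
    have : d * n * (ε ^ p / 2 / (d * n * (V + 1))) * V = ε ^ p / 2 * (V / (V + 1)) := by
      field_simp
    rw [this]
    exact mul_le_of_le_one_right (by positivity) ((div_le_one (by positivity)).2 (by linarith))
  have hC : 0 < d * n * (2 * B) ^ p := by positivity
  obtain ⟨S, hS, hSν, g, hg, hgB, hgf⟩ := SeqTransformer.exists_networkPE_approx (MeasureTheory.volume.restrict D') hD'
    (f := f) hf hB.le hfB hη
    -- The other half pays for `S`, where `f` and `g` are bounded by `B` and so differ by at most `2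
    -- * B` in each entry.
    (ν := ENNReal.ofReal (ε ^ p / 2 / (d * n * (2 * B) ^ p))) (by
      rw [ne_eq, ENNReal.ofReal_eq_zero, not_le]
      positivity)
  refine ⟨g, hg, ?_⟩
  have hpt : ∀ X ∈ D', ENNReal.ofReal (SeqTransformer.entryNorm p (f (Matrix.of X) - g (Matrix.of X)) ^ p) ≤
      ENNReal.ofReal (d * n * η ^ p) +
        S.indicator (fun _ => ENNReal.ofReal (d * n * (2 * B) ^ p)) X := by
    intro X hX
    by_cases hXS : X ∈ S
    · rw [Set.indicator_of_mem hXS]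
      refine le_add_left (ENNReal.ofReal_le_ofReal (SeqTransformer.entryNorm_rpow_le hp₀ fun i j => ?_))
      rw [Matrix.sub_apply]
      have h₁ := hfB (Matrix.of X) hX i j
      have h₂ := hgB (Matrix.of X) i j
      exact (abs_sub _ _).trans (by linarith)
    · refine le_add_right (ENNReal.ofReal_le_ofReal (SeqTransformer.entryNorm_rpow_le hp₀ fun i j => ?_))
      rw [Matrix.sub_apply, abs_sub_comm]
      exact hgf X hX hXS i j
  have hint : ∫⁻ X in D', ENNReal.ofReal (SeqTransformer.entryNorm p (f (Matrix.of X) - g (Matrix.of X)) ^ p) ≤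
      ENNReal.ofReal (ε ^ p) := by
    calc _ ≤ ∫⁻ X in D', ENNReal.ofReal (d * n * η ^ p) +
          S.indicator (fun _ => ENNReal.ofReal (d * n * (2 * B) ^ p)) X :=
          MeasureTheory.setLIntegral_mono' hD'.measurableSet hpt
      _ = ENNReal.ofReal (d * n * η ^ p * V) +
          ENNReal.ofReal (d * n * (2 * B) ^ p) * MeasureTheory.volume.restrict D' S := by
          rw [MeasureTheory.lintegral_add_left measurable_const, MeasureTheory.setLIntegral_const,
            MeasureTheory.lintegral_indicator_const hS, hVD, ← ENNReal.ofReal_mul (by positivity)]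
      _ ≤ ENNReal.ofReal (ε ^ p / 2) + ENNReal.ofReal (d * n * (2 * B) ^ p) *
          ENNReal.ofReal (ε ^ p / 2 / (d * n * (2 * B) ^ p)) := by
          gcongr
      _ = ENNReal.ofReal (ε ^ p) := by
          rw [← ENNReal.ofReal_mul hC.le, mul_div_cancel₀ _ hC.ne',
            ← ENNReal.ofReal_add (by positivity) (by positivity), add_halves]
  calc SeqTransformer.dist p D f g ≤ ENNReal.ofReal (ε ^ p) ^ (1 / p) := by
        exact ENNReal.rpow_le_rpow hint (by positivity)
    _ = ENNReal.ofReal ε := by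
        rw [ENNReal.ofReal_rpow_of_pos hεp, ← Real.rpow_mul hε.le, mul_one_div_cancel hp₀.ne',
          Real.rpow_one]
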